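/- Let $n\ge 1$ be an integer and let $s,t$ be real numbers with $t>0$ and $$\frac{s}{t} > \frac{n^2}{\cosh^{-1}(2)},$$ where $\cosh^{-1}(2)=\ln(2+\sqrt3)$ is the inverse hyperbolic cosine of $2$. Let $\mathcal G$ be the set of all real $n\times n$ upper Hessenberg matrices $A=(a_{ij})$ with $a_{ij}\in[0,t]$ for $i\le j$, $a_{j+1,j}=s$ for $1\le j\le n-1$, and $a_{ij}=0$ for $i>j+1$. Then $$\max_{A\in\mathcal G}|\det A| = s^{n-1}t+\Big\lfloor \frac n2\Big\rfloor\Big\lfloor \frac{n-1}2\Big\rfloor s^{n-3}t^3 .$$ The maximum is attained by the matrix $W_n\in\mathcal G$ defined as follows. Put $k=\lfloor (n-1)/2\rfloor$. The subdiagonal entries of $W_n$ are $s$; its entries equal to $t$ are those in positions $(1,j)$ with $1\le j\le k$, position $(1,n)$, positions $(i,j)$ with $2\le i\le k+1\le j\le n-1$, and positions $(i,n)$ with $k+2\le i\le n$; all its other entries are $0$. Moreover $1/\cosh^{-1}(2)<\tfrac45$, so all of this holds in particular whenever $s/t>\tfrac45 n^2$. -/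

import Mathlib

/-- `hessenbergSet n s P` is the set of all `n × n` upper Hessenberg real matrices whose
subdiagonal entries are all equal to `s` and whose upper triangular entries (the diagonal
included) belong to `P`. -/
def hessenbergSet (n : ℕ) (s : ℝ) (P : Set ℝ) : Set (Matrix (Fin n) (Fin n) ℝ) :=
  {A | (∀ i j : Fin n, i ≤ j → A i j ∈ P) ∧
    (∀ i j : Fin n, (i : ℕ) = (j : ℕ) + 1 → A i j = s) ∧
    (∀ i j : Fin n, (j : ℕ) + 1 < (i : ℕ) → A i j = 0)}

/-- The block matrix `W_n`, with `k = ⌊(n - 1) / 2⌋`, so that `n = 2 k + 1` or `n = 2 k + 2`.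
In terms of rows and columns numbered from `1` to `n`: the subdiagonal entries are `s`; the entries
equal to `t` are those at `(1, j)` for `j ≤ k`, the corner `(1, n)`, the block of rows `2, …, k + 1`
and columns `k + 1, …, n - 1`, and those at `(i, n)` for `i ≥ k + 2`; all others are `0`.
(In the code, rows and columns are numbered from `0`.) -/
def matW (n : ℕ) (s t : ℝ) : Matrix (Fin n) (Fin n) ℝ :=
  Matrix.of fun i j =>
    if (i : ℕ) = (j : ℕ) + 1 then s
    else if ((i : ℕ) = 0 ∧ (j : ℕ) < (n - 1) / 2)
        ∨ ((i : ℕ) = 0 ∧ (j : ℕ) + 1 = n)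
        ∨ (1 ≤ (i : ℕ) ∧ (i : ℕ) ≤ (n - 1) / 2 ∧ (n - 1) / 2 ≤ (j : ℕ) ∧ (j : ℕ) + 1 < n)
        ∨ ((n - 1) / 2 < (i : ℕ) ∧ (j : ℕ) + 1 = n) then t
    else 0

/-- The value `s^(n-1) t + ⌊n/2⌋ ⌊(n-1)/2⌋ s^(n-3) t^3`. For `n = 1` and `n = 2` the integer
coefficient of the second term is `0`, so truncated subtraction in the exponent is harmless. -/
def maxDetValue (n : ℕ) (s t : ℝ) : ℝ :=
  s ^ (n - 1) * t + ((n / 2 : ℕ) : ℝ) * (((n - 1) / 2 : ℕ) : ℝ) * s ^ (n - 3) * t ^ 3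

/-! Put `ε = t / s`. Shifting the columns of `A` by one makes the subdiagonal a diagonal: `A` is `s
(1 + ε N)` without its last row and first column, where `N` is strictly upper triangular of size `n
+ 1` and carries the entries `A i j / t`. By Cramer's rule `|det A| = s ^ (n - 1) t |G 0 n|` with `G
= N - ε N² + ε² N³ - ⋯`, a signed count of increasing paths from `0` to `n`
(`abs_det_eq_of_mem_hessenbergSet`). The determinant is affine in each entry, so for the upper bound
`N` may be taken as the adjacency matrix of a graph (`abs_det_le_of_forall_vertex`).

The hypothesis enters only as `ε n² ≤ 4 / 3`, since `arcosh 2 < 4 / 3`. It makes longer paths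
negligible. A path of length two costs `ε`, and all longer ones together regain at most `ε`. Without
such a path, the out-neighbours `U` of `0` and the in-neighbours `V` of `n` are disjoint, and the
gain is `ε²` times the sum of `G` over `U × V`. That sum is at most the largest `|U| |V|` with `|U|
+ |V| ≤ n - 1` (`apply_zero_last_le`). A complete bipartite graph between two halves of the interior
attains this; it is the graph of `matW`. -/

/-- `G` is the alternating path sum `N - ε N² + ε² N³ - ⋯` of a strictly upper triangular `N`,
characterized by its two resolvent equations. -/
structure IsAlternatingPathSum {m : ℕ} (ε : ℝ) (N G : Matrix (Fin m) (Fin m) ℝ) : Prop where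
  upper : ∀ p q, q ≤ p → N p q = 0
  left : G = N - ε • (N * G)
  right : G = N - ε • (G * N)

/-! ### Recursions and crude bounds for path sums -/

namespace IsAlternatingPathSum

variable {m : ℕ} {ε : ℝ} {N G : Matrix (Fin m) (Fin m) ℝ}

theorem apply_left (h : IsAlternatingPathSum ε N G) (p q : Fin m) :
    G p q = N p q - ε * ∑ r, N p r * G r q := by
  have := congrFun (congrFun h.left p) q
  simpa [Matrix.mul_apply] using this

theorem apply_right (h : IsAlternatingPathSum ε N G) (p q : Fin m) :
    G p q = N p q - ε * ∑ r, G p r * N r q := by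
  have := congrFun (congrFun h.right p) q
  simpa [Matrix.mul_apply] using this

/-- Separates paths of length one, two and at least three; the last are grouped by their first and
last steps. -/
theorem apply_two_sided (h : IsAlternatingPathSum ε N G) (p q : Fin m) :
    G p q = N p q - ε * ∑ r, N p r * N r q + ε ^ 2 * ∑ i, ∑ j, N p i * G i j * N j q := by
  rw [h.apply_left p q]
  have : ∀ r, N p r * G r q = N p r * N r q - ε * ∑ j, N p r * G r j * N j q := by
    intro r
    simp_rw [h.apply_right r q, mul_assoc, ← Finset.mul_sum]
    ring
  rw [Finset.sum_congr rfl fun r _ => this r, Finset.sum_sub_distrib, ← Finset.mul_sum]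
  ring

theorem eq_zero_of_le (h : IsAlternatingPathSum ε N G) (p q : Fin m) (hpq : q ≤ p) :
    G p q = 0 := by
  induction hk : m - (p : ℕ) using Nat.strong_induction_on generalizing p with
  | _ k ih =>
    rw [h.apply_left, h.upper p q hpq, Finset.sum_eq_zero, mul_zero, sub_zero]
    intro r _
    rcases le_or_gt r p with hr | hr
    · rw [h.upper p r hr, zero_mul]
    · rw [ih (m - r) (by omega) r (hpq.trans hr.le) rfl, mul_zero]

/-- With entries in `[0, 1]` and `ε (m - 2) ≤ 1 / 3`, all alternating path sums are small. -/
theorem abs_le {n : ℕ} {N G : Matrix (Fin (n + 1)) (Fin (n + 1)) ℝ}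
    (h : IsAlternatingPathSum ε N G) (hε : 0 ≤ ε)
    (hn : ε * (n - 1 : ℕ) ≤ 1 / 3) (h01 : ∀ p q, N p q ∈ Set.Icc (0 : ℝ) 1)
    (p q : Fin (n + 1)) : |G p q| ≤ 3 / 2 := by
  induction hk : n + 1 - (p : ℕ) using Nat.strong_induction_on generalizing p with
  | _ k ih =>
    -- The bound `3 / 2` reproduces itself: `1 + (1 / 3) * (3 / 2) = 3 / 2`.
    have hsum : |∑ r, N p r * G r q| ≤ (n - 1 : ℕ) * (3 / 2) := by
      calc |∑ r, N p r * G r q| ≤ ∑ r, |N p r * G r q| := Finset.abs_sum_le_sum_abs _ _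
        _ ≤ ∑ r, if r ∈ Finset.Ioo p q then (3 / 2 : ℝ) else 0 := by
          refine Finset.sum_le_sum fun r _ => ?_
          split_ifs with hr
          · rw [Finset.mem_Ioo] at hr
            have h1 := ih (n + 1 - r) (by omega) r rfl
            rw [abs_mul, abs_of_nonneg (h01 p r).1]
            exact (mul_le_of_le_one_left (abs_nonneg _) (h01 p r).2).trans h1
          · rw [Finset.mem_Ioo, not_and_or, not_lt, not_lt] at hr
            rcases hr with hr | hr
            · simp [h.upper p r hr]
            · simp [h.eq_zero_of_le r q hr]
        _ = ((Finset.Ioo p q).card : ℝ) * (3 / 2) := by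
          rw [Finset.sum_ite_mem, Finset.univ_inter, Finset.sum_const, nsmul_eq_mul]
        _ ≤ (n - 1 : ℕ) * (3 / 2) := by
          gcongr
          rw [Fin.card_Ioo]
          omega
    rw [h.apply_left, _root_.abs_le]
    rw [_root_.abs_le] at hsum
    have h1 := mul_le_mul_of_nonneg_left hsum.1 hε
    have h2 := mul_le_mul_of_nonneg_left hsum.2 hε
    have := (h01 p q).1
    have := (h01 p q).2
    constructor <;> linarith

end IsAlternatingPathSum

/-- A finite linear order has at most `|S|² / 2` increasing pairs in a subset `S`. -/
theorem two_mul_sum_lt_le {α : Type*} [LinearOrder α] (S : Finset α) :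
    2 * ∑ i ∈ S, ∑ j ∈ S, (if i < j then (1 : ℝ) else 0) ≤ (S.card : ℝ) ^ 2 := by
  have h : ∑ i ∈ S, ∑ j ∈ S, (if i < j then (1 : ℝ) else 0)
      = ∑ i ∈ S, ∑ j ∈ S, (if j < i then (1 : ℝ) else 0) := Finset.sum_comm
  calc 2 * ∑ i ∈ S, ∑ j ∈ S, (if i < j then (1 : ℝ) else 0)
      = ∑ i ∈ S, ∑ j ∈ S, ((if i < j then (1 : ℝ) else 0) + (if j < i then (1 : ℝ) else 0)) := by
        simp only [Finset.sum_add_distrib]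
        rw [← h]
        ring
    _ ≤ ∑ i ∈ S, ∑ j ∈ S, (1 : ℝ) := by
        refine Finset.sum_le_sum fun i _ => Finset.sum_le_sum fun j _ => ?_
        rcases lt_trichotomy i j with hij | hij | hij
        · simp [hij, hij.not_gt]
        · simp [hij]
        · simp [hij, hij.not_gt]
    _ = (S.card : ℝ) ^ 2 := by simp [sq]

/-! ### Estimates under `ε n² ≤ 4 / 3` -/

namespace IsAlternatingPathSum

variable {n : ℕ} {ε : ℝ} {N G : Matrix (Fin (n + 1)) (Fin (n + 1)) ℝ}

/-- From `(n - 2)² ≥ 0` one gets `4 (n - 1) ≤ n²`. -/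
theorem mul_pred_le (hε : 0 ≤ ε) (hn : ε * (n : ℝ) ^ 2 ≤ 4 / 3) : ε * (n - 1 : ℕ) ≤ 1 / 3 := by
  have h : 4 * ((n - 1 : ℕ) : ℝ) ≤ (n : ℝ) ^ 2 := by
    rcases n with _ | n
    · simp
    · push_cast [Nat.add_sub_cancel]
      nlinarith [sq_nonneg ((n : ℝ) - 1)]
  nlinarith [mul_le_mul_of_nonneg_left h hε]

/-- Paths of length at least three contribute at most `ε`. -/
theorem mul_sum_le_one (h : IsAlternatingPathSum ε N G) (hε : 0 ≤ ε)
    (hn : ε * (n : ℝ) ^ 2 ≤ 4 / 3) (h01 : ∀ p q, N p q ∈ Set.Icc (0 : ℝ) 1)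
    (p q : Fin (n + 1)) : ε * ∑ i, ∑ j, N p i * G i j * N j q ≤ 1 := by
  have habs := h.abs_le hε (mul_pred_le hε hn) h01
  have hle : ∑ i, ∑ j, N p i * G i j * N j q
      ≤ 3 / 2 * ∑ i ∈ Finset.Ioo p q, ∑ j ∈ Finset.Ioo p q, (if i < j then (1 : ℝ) else 0) := by
    rw [Finset.mul_sum]
    simp_rw [Finset.mul_sum]
    rw [← Finset.univ_inter (Finset.Ioo p q), ← Finset.sum_ite_mem Finset.univ]
    refine Finset.sum_le_sum fun i _ => ?_
    rw [← Finset.sum_ite_mem Finset.univ]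
    split_ifs with hi
    · refine Finset.sum_le_sum fun j _ => ?_
      have hb : N p i * G i j * N j q ≤ 3 / 2 := by
        have h1 := (_root_.abs_le.mp (habs i j)).2
        have : N p i * N j q ≤ 1 := mul_le_one₀ (h01 _ _).2 (h01 _ _).1 (h01 _ _).2
        have h0 : 0 ≤ N p i * N j q := mul_nonneg (h01 _ _).1 (h01 _ _).1
        nlinarith
      by_cases hij : i < j
      · by_cases hj : j < q
        · have : j ∈ Finset.Ioo p q := by
            rw [Finset.mem_Ioo] at hi ⊢
            exact ⟨hi.1.trans hij, hj⟩
          rw [if_pos this, if_pos hij]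
          linarith
        · rw [h.upper j q (not_lt.mp hj), mul_zero]
          split_ifs <;> norm_num
      · rw [h.eq_zero_of_le i j (not_lt.mp hij)]
        simp [hij]
    · refine (Finset.sum_eq_zero fun j _ => ?_).le
      simp only [Finset.mem_Ioo, not_and_or, not_lt] at hi
      rcases hi with hi | hi
      · simp [h.upper p i hi]
      · rcases le_or_gt j i with hj | hj
        · simp [h.eq_zero_of_le i j hj]
        · simp [h.upper j q (hi.trans hj.le)]
  have hc := two_mul_sum_lt_le (Finset.Ioo p q)
  have hcard : ((Finset.Ioo p q).card : ℝ) ≤ n := by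
    rw [Fin.card_Ioo]
    exact_mod_cast (by omega)
  have hsq : ((Finset.Ioo p q).card : ℝ) ^ 2 ≤ (n : ℝ) ^ 2 := by gcongr
  -- At most `n² / 2` pairs, each contributing at most `3 / 2`.
  have := mul_le_mul_of_nonneg_left (hle.trans (by linarith :
    _ ≤ 3 / 4 * (n : ℝ) ^ 2)) hε
  linarith

/-- Paths of length two enter with a negative sign and may be dropped. -/
theorem le_add (h : IsAlternatingPathSum ε N G) (hε : 0 ≤ ε)
    (hn : ε * (n : ℝ) ^ 2 ≤ 4 / 3) (h01 : ∀ p q, N p q ∈ Set.Icc (0 : ℝ) 1)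
    (p q : Fin (n + 1)) : G p q ≤ N p q + ε := by
  have h1 := mul_le_mul_of_nonneg_left (h.mul_sum_le_one hε hn h01 p q) hε
  have h2 : 0 ≤ ε * ∑ r, N p r * N r q :=
    mul_nonneg hε (Finset.sum_nonneg fun r _ => mul_nonneg (h01 _ _).1 (h01 _ _).1)
  rw [h.apply_two_sided]
  linarith

/-- Keeps a negative corner from spoiling the bound on `|G 0 n|`. -/
theorem neg_one_le (h : IsAlternatingPathSum ε N G) (hε : 0 ≤ ε)
    (hn : ε * (n : ℝ) ^ 2 ≤ 4 / 3) (h01 : ∀ p q, N p q ∈ Set.Icc (0 : ℝ) 1)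
    (p q : Fin (n + 1)) : -1 ≤ G p q := by
  have habs := h.abs_le hε (mul_pred_le hε hn) h01
  have hsum : ∑ r, N p r * G r q ≤ ∑ r, if r ∈ Finset.Ioo p q then (3 / 2 : ℝ) else 0 := by
    refine Finset.sum_le_sum fun r _ => ?_
    split_ifs with hr
    · have h1 := (_root_.abs_le.mp (habs r q)).2
      nlinarith [(h01 p r).1, (h01 p r).2]
    · rw [Finset.mem_Ioo, not_and_or, not_lt, not_lt] at hr
      rcases hr with hr | hr
      · simp [h.upper p r hr]
      · simp [h.eq_zero_of_le r q hr]
  have hcard : ∑ r, (if r ∈ Finset.Ioo p q then (3 / 2 : ℝ) else 0) ≤ (n - 1 : ℕ) * (3 / 2) := by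
    rw [Finset.sum_ite_mem, Finset.univ_inter, Finset.sum_const, nsmul_eq_mul]
    gcongr
    rw [Fin.card_Ioo]
    omega
  have h3 := mul_le_mul_of_nonneg_left (hsum.trans hcard) hε
  have h4 := mul_pred_le hε hn
  rw [h.apply_left]
  linarith [(h01 p q).1]

end IsAlternatingPathSum

/-! ### Products of integers with bounded sum -/

/-- Numbers with sum at most `n - 1` have product at most `⌊n / 2⌋ ⌊(n - 1) / 2⌋`. -/
theorem mul_le_half_mul_half {a b n : ℕ} (h : a + b ≤ n - 1) : a * b ≤ n / 2 * ((n - 1) / 2) := by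
  obtain ⟨k, hk | hk⟩ : ∃ k, n = 2 * k + 1 ∨ n = 2 * k + 2 ∨ n = 0 := ⟨(n - 1) / 2, by omega⟩
  · rw [show n / 2 = k by omega, show (n - 1) / 2 = k by omega]
    have h : a + b ≤ 2 * k := by omega
    zify at h ⊢
    nlinarith [sq_nonneg ((a : ℤ) - b)]
  · rcases hk with hk | hk
    · rw [show n / 2 = k + 1 by omega, show (n - 1) / 2 = k by omega]
      have h : a + b ≤ 2 * k + 1 := by omega
      rcases le_or_gt a k with ha | ha
      · obtain ⟨c, rfl⟩ := Nat.exists_eq_add_of_le ha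
        have : b ≤ a + 2 * c + 1 := by omega
        nlinarith
      · obtain ⟨c, rfl⟩ := Nat.exists_eq_add_of_lt ha
        have : b + c ≤ k := by omega
        nlinarith
    · simp [show a = 0 by omega]

/-- Numbers with sum at most `n - 1` and maximal nonzero product have sum equal to `n - 1`. -/
theorem add_eq_of_half_mul_half_le {a b n : ℕ} (h : a + b ≤ n - 1) (hab : 0 < a * b)
    (hle : n / 2 * ((n - 1) / 2) ≤ a * b) : a + b = n - 1 := by
  by_contra hne
  have ha : 0 < a := Nat.pos_of_mul_pos_right hab
  have hb : 0 < b := Nat.pos_of_mul_pos_left hab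
  -- With slack in the sum, raising `a` by one would exceed the maximal product.
  have h1 := mul_le_half_mul_half (a := a + 1) (b := b) (n := n) (by omega)
  nlinarith

/-! ### The sharp bound for the corner -/

namespace IsAlternatingPathSum

variable {n : ℕ} {ε : ℝ} {N G : Matrix (Fin (n + 1)) (Fin (n + 1)) ℝ}

/-- If of any two vertices `r < s` between `p` and `q` either `r` is adjacent to `q` or `s` to `p`,
the paths of length at least three from `p` to `q` are dominated by those of length two. -/
theorem apply_le_one (h : IsAlternatingPathSum ε N G) (hε : 0 ≤ ε)
    (hn : ε * (n : ℝ) ^ 2 ≤ 4 / 3) (h01 : ∀ p q, N p q ∈ Set.Icc (0 : ℝ) 1)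
    (p q : Fin (n + 1))
    (hpq : ∀ r s, p < r → r < s → s < q → N r q = 1 ∨ N p s = 1) : G p q ≤ 1 := by
  have habs := h.abs_le hε (mul_pred_le hε hn) h01
  set T := ∑ r, N p r * N r q with hT
  set S := Finset.Ioo (0 : Fin (n + 1)) (Fin.last n) with hS
  -- Each long path is charged to a path of length two, through `r` or through `s`. The indicators
  -- of the interior `S` ensure that a path of length two is charged at most `n - 1` times from
  -- either side, so the total is at most `3 (n - 1) T`, and `3 ε (n - 1) ≤ 1`.
  have hterm : ∀ r s, N p r * G r s * N s q
      ≤ 3 / 2 * ((if s ∈ S then N p r * N r q else 0) + (if r ∈ S then N p s * N s q else 0)) := by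
    intro r s
    have hn1 : 0 ≤ N p r * N r q := mul_nonneg (h01 _ _).1 (h01 _ _).1
    have hn2 : 0 ≤ N p s * N s q := mul_nonneg (h01 _ _).1 (h01 _ _).1
    have hnn : 0 ≤ 3 / 2 *
        ((if s ∈ S then N p r * N r q else 0) + (if r ∈ S then N p s * N s q else 0)) := by
      split_ifs <;> positivity
    rcases le_or_gt r p with hr | hr
    · refine le_trans (le_of_eq ?_) hnn
      rw [h.upper p r hr, zero_mul, zero_mul]
    rcases le_or_gt q s with hs | hs
    · refine le_trans (le_of_eq ?_) hnn
      rw [h.upper s q hs, mul_zero]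
    rcases le_or_gt s r with hrs | hrs
    · refine le_trans (le_of_eq ?_) hnn
      rw [h.eq_zero_of_le r s hrs, mul_zero, zero_mul]
    have hs1 : s < Fin.last n := hs.trans_le (Fin.le_last q)
    have hr0 : 0 < r := (Fin.zero_le p).trans_lt hr
    rw [if_pos (Finset.mem_Ioo.mpr ⟨hr0.trans hrs, hs1⟩),
      if_pos (Finset.mem_Ioo.mpr ⟨hr0, hrs.trans hs1⟩)]
    have hG := (_root_.abs_le.mp (habs r s)).2
    have h0 : 0 ≤ N p r * N s q := mul_nonneg (h01 _ _).1 (h01 _ _).1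
    have h1 : N p r * G r s * N s q ≤ 3 / 2 * (N p r * N s q) := by nlinarith
    have h2 : N p r * N s q ≤ N p r := mul_le_of_le_one_right (h01 _ _).1 (h01 _ _).2
    have h3 : N p r * N s q ≤ N s q := mul_le_of_le_one_left (h01 _ _).1 (h01 _ _).2
    rcases hpq r s hr hrs hs with h4 | h4
    · rw [h4, mul_one] at hn1 ⊢
      linarith
    · rw [h4, one_mul] at hn2 ⊢
      linarith
  have hcount : ∀ c : ℝ, ∑ s : Fin (n + 1), (if s ∈ S then c else 0) = (n - 1 : ℕ) * c := by
    intro c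
    rw [Finset.sum_ite_mem, Finset.univ_inter, Finset.sum_const, nsmul_eq_mul, hS, Fin.card_Ioo]
    simp
  have hsum : ∑ r, ∑ s, N p r * G r s * N s q ≤ 3 * ((n - 1 : ℕ) * T) := by
    refine (Finset.sum_le_sum fun r _ => Finset.sum_le_sum fun s _ => hterm r s).trans_eq ?_
    simp_rw [← Finset.mul_sum, Finset.sum_add_distrib]
    rw [Finset.sum_comm (f := fun r s => if r ∈ S then N p s * N s q else 0)]
    simp_rw [hcount, ← Finset.mul_sum]
    rw [← hT]
    ring
  have hT0 : 0 ≤ T := Finset.sum_nonneg fun r _ => mul_nonneg (h01 _ _).1 (h01 _ _).1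
  have h1 := mul_le_mul_of_nonneg_right (mul_pred_le hε hn) hT0
  have h2 := mul_le_mul_of_nonneg_left hsum (sq_nonneg ε)
  have h3 := mul_le_mul_of_nonneg_left h1 hε
  rw [h.apply_two_sided]
  linarith [(h01 p q).2]

/-- For adjacency matrices the corner path sum is bounded by that of `matW`. -/
theorem apply_zero_last_le (h : IsAlternatingPathSum ε N G) (hε : 0 ≤ ε)
    (hn : ε * (n : ℝ) ^ 2 ≤ 4 / 3) (h01 : ∀ p q, N p q = 0 ∨ N p q = 1) :
    G 0 (Fin.last n) ≤ 1 + ε ^ 2 * ((n / 2 * ((n - 1) / 2) : ℕ) : ℝ) := by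
  have hIcc : ∀ p q, N p q ∈ Set.Icc (0 : ℝ) 1 := fun p q => by
    rcases h01 p q with h | h <;> simp [h]
  have hnn : ∀ p r q, 0 ≤ N p r * N r q := fun p r q =>
    mul_nonneg (hIcc _ _).1 (hIcc _ _).1
  by_cases hdis : ∃ r, N 0 r = 1 ∧ N r (Fin.last n) = 1
  · obtain ⟨r, hr1, hr2⟩ := hdis
    have h1 : 1 ≤ ∑ r, N 0 r * N r (Fin.last n) := by
      have := Finset.single_le_sum (f := fun r => N 0 r * N r (Fin.last n))
        (fun r _ => hnn 0 r _) (Finset.mem_univ r)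
      simpa [hr1, hr2] using this
    have h2 := h.mul_sum_le_one hε hn hIcc 0 (Fin.last n)
    have h3 := mul_le_mul_of_nonneg_left h1 hε
    have h4 := mul_le_mul_of_nonneg_left h2 hε
    have h5 : 0 ≤ ε ^ 2 * ((n / 2 * ((n - 1) / 2) : ℕ) : ℝ) := by positivity
    rw [h.apply_two_sided]
    linarith [(hIcc 0 (Fin.last n)).2]
  · push Not at hdis
    set U := Finset.univ.filter fun r => N 0 r = 1 ∧ r ≠ Fin.last n with hU
    set V := Finset.univ.filter fun r => N r (Fin.last n) = 1 ∧ r ≠ 0 with hV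
    have hUV : Disjoint U V := by
      rw [Finset.disjoint_left]
      intro r hr hr'
      simp only [hU, hV, Finset.mem_filter, Finset.mem_univ, true_and] at hr hr'
      exact hdis r hr.1 hr'.1
    have hsub : U ∪ V ⊆ Finset.Ioo 0 (Fin.last n) := by
      intro r hr
      simp only [hU, hV, Finset.mem_union, Finset.mem_filter, Finset.mem_univ, true_and] at hr
      rw [Finset.mem_Ioo]
      rcases hr with ⟨hr, hr'⟩ | ⟨hr, hr'⟩
      · refine ⟨not_le.mp fun hle => ?_, Fin.lt_last_iff_ne_last.mpr hr'⟩
        rw [h.upper 0 r hle] at hr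
        exact zero_ne_one hr
      · refine ⟨Fin.pos_iff_ne_zero.mpr hr', not_le.mp fun hle => ?_⟩
        rw [h.upper r _ hle] at hr
        exact zero_ne_one hr
    have hcardIoo : (Finset.Ioo (0 : Fin (n + 1)) (Fin.last n)).card = n - 1 := by
      simp [Fin.card_Ioo]
    have hcard : U.card + V.card ≤ n - 1 := by
      rw [← Finset.card_union_of_disjoint hUV, ← hcardIoo]
      exact Finset.card_le_card hsub
    have hprod := mul_le_half_mul_half hcard
    have hG0 : ∀ p q, q ≤ p → G p q = 0 := h.eq_zero_of_le
    have hsum : ∑ i, ∑ j, N 0 i * G i j * N j (Fin.last n) = ∑ x ∈ U ×ˢ V, G x.1 x.2 := by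
      rw [Finset.sum_product, hU, Finset.sum_filter]
      refine Finset.sum_congr rfl fun i _ => ?_
      split_ifs with hi
      · rw [hV, Finset.sum_filter]
        refine Finset.sum_congr rfl fun j _ => ?_
        rw [hi.1, one_mul]
        split_ifs with hj
        · rw [hj.1, mul_one]
        · rw [not_and_or, not_not] at hj
          rcases hj with hj | hj
          · rw [(h01 _ _).resolve_right hj, mul_zero]
          · rw [hG0 i j (by simp [hj]), zero_mul]
      · refine Finset.sum_eq_zero fun j _ => ?_
        rw [not_and_or, not_not] at hi
        rcases hi with hi | hi
        · rw [(h01 _ _).resolve_right hi, zero_mul, zero_mul]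
        · rw [hG0 i j (by simp [hi, Fin.le_last]), mul_zero, zero_mul]
    have htwo : ∑ r, N 0 r * N r (Fin.last n) = 0 := by
      refine Finset.sum_eq_zero fun r _ => ?_
      rcases h01 0 r with hr | hr
      · rw [hr, zero_mul]
      · rw [(h01 _ _).resolve_right (hdis r hr), mul_zero]
    suffices hmain : ∑ x ∈ U ×ˢ V, G x.1 x.2 ≤ ((n / 2 * ((n - 1) / 2) : ℕ) : ℝ) by
      rw [h.apply_two_sided, htwo, hsum]
      have := mul_le_mul_of_nonneg_left hmain (sq_nonneg ε)
      linarith [(hIcc 0 (Fin.last n)).2]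
    -- In the extremal configuration an error of `ε` per pair would be too much, so `apply_le_one`
    -- is needed.
    by_cases hall : (∀ x ∈ U ×ˢ V, N x.1 x.2 = 1) ∧ U.card + V.card = n - 1
    · obtain ⟨hone, hfull⟩ := hall
      have heq : U ∪ V = Finset.Ioo 0 (Fin.last n) :=
        Finset.eq_of_subset_of_card_le hsub
          (by rw [Finset.card_union_of_disjoint hUV, hfull, hcardIoo])
      calc ∑ x ∈ U ×ˢ V, G x.1 x.2 ≤ ∑ x ∈ U ×ˢ V, (1 : ℝ) := by
            refine Finset.sum_le_sum fun x hx => ?_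
            rw [Finset.mem_product] at hx
            refine h.apply_le_one hε hn hIcc _ _ fun r s hr hrs hs => ?_
            have hr : r ∈ U ∪ V := by
              rw [heq, Finset.mem_Ioo]
              exact ⟨(Fin.zero_le _).trans_lt hr, (hrs.trans hs).trans_le (Fin.le_last _)⟩
            have hs : s ∈ U ∪ V := by
              rw [heq, Finset.mem_Ioo]
              exact ⟨(Fin.zero_le _).trans_lt hrs, hs.trans_le (Fin.le_last _)⟩
            rcases Finset.mem_union.mp hr with hr | hr
            · exact Or.inl (hone (r, x.2) (Finset.mem_product.mpr ⟨hr, hx.2⟩))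
            · rcases Finset.mem_union.mp hs with hs | hs
              -- `r ∈ V` and `s ∈ U` would force an edge from `s` down to `r`.
              · have := hone (s, r) (Finset.mem_product.mpr ⟨hs, hr⟩)
                rw [h.upper s r hrs.le] at this
                exact absurd this zero_ne_one
              · exact Or.inr (hone (x.1, s) (Finset.mem_product.mpr ⟨hx.1, hs⟩))
        _ ≤ _ := by
          rw [Finset.sum_const, nsmul_eq_mul, mul_one, Finset.card_product]
          exact_mod_cast hprod
    -- Otherwise, by integrality, at least one edge is missing relative to the maximum. The total
    -- error `ε |U| |V| ≤ ε n² / 4 ≤ 1 / 3` fits into this gap.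
    · have hεc : ε * (U.card * V.card : ℕ) ≤ 1 := by
        have : ((U.card * V.card : ℕ) : ℝ) * 4 ≤ (n : ℝ) ^ 2 := by
          have : U.card * V.card * 4 ≤ n ^ 2 := by
            have h1 : U.card + V.card ≤ n := by omega
            zify at h1 ⊢
            nlinarith [sq_nonneg ((U.card : ℤ) - V.card)]
          exact_mod_cast this
        nlinarith [mul_le_mul_of_nonneg_left this hε]
      have hle : ∑ x ∈ U ×ˢ V, G x.1 x.2
          ≤ (((U ×ˢ V).filter fun x => N x.1 x.2 = 1).card : ℝ) + ε * (U.card * V.card : ℕ) := by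
        calc ∑ x ∈ U ×ˢ V, G x.1 x.2
            ≤ ∑ x ∈ U ×ˢ V, ((if N x.1 x.2 = 1 then 1 else 0) + ε) := by
              refine Finset.sum_le_sum fun x _ => (h.le_add hε hn hIcc x.1 x.2).trans_eq ?_
              rcases h01 x.1 x.2 with hx | hx <;> simp [hx]
          _ = _ := by
              rw [Finset.sum_add_distrib, Finset.sum_boole, Finset.sum_const, nsmul_eq_mul,
                Finset.card_product]
              ring
      rcases Nat.eq_zero_or_pos (U.card * V.card) with hz | hpos
      · rw [← Finset.card_product, Finset.card_eq_zero] at hz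
        rw [hz, Finset.sum_empty]
        positivity
      have hlt : ((U ×ˢ V).filter fun x => N x.1 x.2 = 1).card + 1 ≤ n / 2 * ((n - 1) / 2) := by
        by_contra hcon
        have hle1 : ((U ×ˢ V).filter fun x => N x.1 x.2 = 1).card ≤ (U ×ˢ V).card :=
          Finset.card_filter_le _ _
        have hc := Finset.card_product U V
        refine hall ⟨?_, add_eq_of_half_mul_half_le hcard hpos (by omega)⟩
        exact Finset.card_filter_eq_iff.mp (by omega)
      have hlt' : (((U ×ˢ V).filter fun x => N x.1 x.2 = 1).card : ℝ) + 1
          ≤ ((n / 2 * ((n - 1) / 2) : ℕ) : ℝ) := by exact_mod_cast hlt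
      linarith

end IsAlternatingPathSum

/-! ### From Hessenberg determinants to path sums -/

/-- The strictly upper triangular matrix with the entries `A i j / t` at `(i, j + 1)`, `i ≤ j`. -/
noncomputable def pathMatrix {n : ℕ} (t : ℝ) (A : Matrix (Fin n) (Fin n) ℝ) :
    Matrix (Fin (n + 1)) (Fin (n + 1)) ℝ :=
  Matrix.of fun p q =>
    Fin.lastCases 0 (fun i => Fin.cases 0 (fun j => if i ≤ j then A i j / t else 0) q) p

section pathMatrix

variable {n : ℕ} (s t : ℝ) (A : Matrix (Fin n) (Fin n) ℝ)

theorem pathMatrix_castSucc_succ (i j : Fin n) :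
    pathMatrix t A i.castSucc j.succ = if i ≤ j then A i j / t else 0 := by
  simp [pathMatrix]

theorem pathMatrix_last (q : Fin (n + 1)) : pathMatrix t A (Fin.last n) q = 0 := by
  simp [pathMatrix]

theorem pathMatrix_zero (p : Fin (n + 1)) : pathMatrix t A p 0 = 0 := by
  induction p using Fin.lastCases <;> simp [pathMatrix]

/-- A property of all entries of the path matrix may be checked on `0` and the entries of `A`. -/
theorem pathMatrix_mem {P : Set ℝ} (h0 : (0 : ℝ) ∈ P) (h : ∀ i j, i ≤ j → A i j / t ∈ P)
    (p q : Fin (n + 1)) : pathMatrix t A p q ∈ P := by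
  induction p using Fin.lastCases with
  | last => rwa [pathMatrix_last]
  | cast i =>
    induction q using Fin.cases with
    | zero => rwa [pathMatrix_zero]
    | succ j =>
      rw [pathMatrix_castSucc_succ]
      split_ifs with hij
      exacts [h i j hij, h0]

theorem pathMatrix_upper (p q : Fin (n + 1)) (hpq : q ≤ p) : pathMatrix t A p q = 0 := by
  induction p using Fin.lastCases with
  | last => rw [pathMatrix_last]
  | cast i =>
    induction q using Fin.cases with
    | zero => rw [pathMatrix_zero]
    | succ j =>
      rw [pathMatrix_castSucc_succ, if_neg]
      rw [Fin.le_def, Fin.val_succ, Fin.val_castSucc] at hpq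
      rw [Fin.le_def]
      omega

/-- The alternating path sums of a Hessenberg matrix, the corner of which is its determinant. -/
noncomputable def pathSum : Matrix (Fin (n + 1)) (Fin (n + 1)) ℝ :=
  pathMatrix t A * (1 + (t / s) • pathMatrix t A)⁻¹

theorem det_one_add_smul_pathMatrix (c : ℝ) : (1 + c • pathMatrix t A).det = 1 := by
  rw [Matrix.det_of_isUpperTriangular]
  · exact Finset.prod_eq_one fun i _ => by simp [pathMatrix_upper t A i i le_rfl]
  · intro i j hij
    have hij : j < i := hij
    simp [pathMatrix_upper t A i j hij.le, Matrix.one_apply_ne hij.ne']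

theorem isAlternatingPathSum_pathSum :
    IsAlternatingPathSum (t / s) (pathMatrix t A) (pathSum s t A) := by
  set N := pathMatrix t A with hN
  set K := (1 + (t / s) • N)⁻¹ with hK
  have hdet : IsUnit (1 + (t / s) • N).det := by simp [hN, det_one_add_smul_pathMatrix]
  have h1 : (1 + (t / s) • N) * K = 1 := Matrix.mul_nonsing_inv _ hdet
  have h2 : K * (1 + (t / s) • N) = 1 := Matrix.nonsing_inv_mul _ hdet
  have h1' : K = 1 - (t / s) • (N * K) := by
    rw [add_mul, one_mul, smul_mul_assoc] at h1
    exact eq_sub_of_add_eq h1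
  have h2' : K = 1 - (t / s) • (K * N) := by
    rw [mul_add, mul_one, mul_smul_comm] at h2
    exact eq_sub_of_add_eq h2
  have hG : pathSum s t A = N * K := rfl
  refine ⟨pathMatrix_upper t A, ?_, ?_⟩
  · rw [hG]
    conv_lhs => rw [h1']
    rw [mul_sub, mul_one, mul_smul_comm]
  · rw [hG]
    conv_lhs => rw [h2']
    rw [mul_sub, mul_one, mul_smul_comm, mul_assoc]

/-- Up to sign `A.det` is a corner of the adjugate of `s • X`, that is `s ^ n` times a corner of
`X⁻¹ = 1 - (t / s) • G`; as `1 ≤ n`, this corner lies off the diagonal. -/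
theorem abs_det_eq_of_mem_hessenbergSet {s t : ℝ} (hn : 1 ≤ n) (hs : 0 < s) (ht : 0 < t)
    {P : Set ℝ} {A : Matrix (Fin n) (Fin n) ℝ} (hA : A ∈ hessenbergSet n s P) :
    |A.det| = s ^ (n - 1) * t * |pathSum s t A 0 (Fin.last n)| := by
  set N := pathMatrix t A with hN
  set X := 1 + (t / s) • N with hX
  have hsub : (s • X).submatrix Fin.castSucc Fin.succ = A := by
    ext i j
    have hval : (s • X) i.castSucc j.succ
        = s * ((1 : Matrix (Fin (n + 1)) (Fin (n + 1)) ℝ) i.castSucc j.succ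
          + t / s * (if i ≤ j then A i j / t else 0)) := by
      rw [hX, ← pathMatrix_castSucc_succ]
      simp [hN]
    rw [Matrix.submatrix_apply, hval, Matrix.one_apply]
    simp only [Fin.ext_iff, Fin.val_castSucc, Fin.val_succ, Fin.le_def]
    rcases lt_trichotomy (i : ℕ) (j + 1) with h | h | h
    · rw [if_neg h.ne, if_pos (by omega)]
      field_simp
      ring
    · rw [if_pos h, if_neg (by omega), hA.2.1 i j h]
      ring
    · rw [if_neg h.ne', if_neg (by omega), hA.2.2 i j h]
      ring
  have hdet : X.det = 1 := det_one_add_smul_pathMatrix t A _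
  have hinv : X.adjugate = X⁻¹ := by simp [Matrix.inv_def, hdet]
  have hadj := Matrix.adjugate_fin_succ_eq_det_submatrix (s • X) 0 (Fin.last n)
  have hcorner : X⁻¹ 0 (Fin.last n) = - (t / s * pathSum s t A 0 (Fin.last n)) := by
    have h1 : X * X⁻¹ = 1 := Matrix.mul_nonsing_inv _ (by simp [hdet])
    have h2 : X * X⁻¹ = X⁻¹ + (t / s) • pathSum s t A := by
      conv_lhs => rw [hX, add_mul, one_mul, smul_mul_assoc]
      rfl
    have h3 := congrFun (congrFun (h2.symm.trans h1) 0) (Fin.last n)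
    have hne : (0 : Fin (n + 1)) ≠ Fin.last n := by
      rw [Ne, Fin.ext_iff]
      simp
      omega
    rw [Matrix.one_apply_ne hne] at h3
    simp only [Matrix.add_apply, Matrix.smul_apply, smul_eq_mul] at h3
    linarith
  rw [Fin.succAbove_last, Fin.succAbove_zero, hsub, Matrix.adjugate_smul, hinv] at hadj
  have habs := congrArg abs hadj
  rw [Matrix.smul_apply, smul_eq_mul, hcorner, abs_mul, abs_mul, abs_neg, abs_mul,
    abs_pow (-1 : ℝ), abs_neg, abs_one, one_pow, one_mul, abs_of_pos (div_pos ht hs),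
    abs_of_nonneg (by positivity)] at habs
  rw [← habs]
  obtain ⟨m, rfl⟩ := Nat.exists_eq_add_of_le' hn
  simp only [Nat.succ_eq_add_one, Fintype.card_fin, Nat.add_sub_cancel, pow_succ]
  field_simp

theorem maxDetValue_eq {s t : ℝ} (hs : 0 < s) (hn : 1 ≤ n) : maxDetValue n s t
    = s ^ (n - 1) * t * (1 + (t / s) ^ 2 * ((n / 2 * ((n - 1) / 2) : ℕ) : ℝ)) := by
  rw [maxDetValue]
  rcases lt_or_ge n 3 with h | h
  · rw [show (n - 1) / 2 = 0 by omega]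
    simp
  · obtain ⟨m, rfl⟩ := Nat.exists_eq_add_of_le' h
    rw [Nat.add_sub_cancel, show m + 3 - 1 = m + 2 by omega]
    push_cast
    field_simp
    ring

end pathMatrix

/-! ### Reduction to entries in `{0, t}` -/

/-- The determinant being affine in every entry, bounds on it extend from the vertices. -/
theorem abs_det_le_of_forall_vertex {n : ℕ} {s t M : ℝ} (ht : 0 < t)
    (hM : ∀ A ∈ hessenbergSet n s {0, t}, |A.det| ≤ M) (A : Matrix (Fin n) (Fin n) ℝ)
    (hA : A ∈ hessenbergSet n s (Set.Icc 0 t)) : |A.det| ≤ M := by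
  -- `S` holds the positions whose entries are not yet known to be `0` or `t`.
  suffices key : ∀ (S : Finset (Fin n × Fin n)) (A : Matrix (Fin n) (Fin n) ℝ),
      A ∈ hessenbergSet n s (Set.Icc 0 t) →
      (∀ i j, i ≤ j → (i, j) ∉ S → A i j = 0 ∨ A i j = t) → |A.det| ≤ M from
    key Finset.univ A hA (by simp)
  intro S
  induction S using Finset.induction_on with
  | empty => exact fun A hA h => hM A ⟨fun i j hij => h i j hij (by simp), hA.2⟩
  | insert x S _ ih =>
    obtain ⟨a, b⟩ := x
    intro A hA h
    by_cases hab : a ≤ b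
    · set B : ℝ → Matrix (Fin n) (Fin n) ℝ :=
        fun y => A.updateRow a (Function.update (A a) b y) with hB
      have hBapp : ∀ y i j, B y i j = if i = a ∧ j = b then y else A i j := by
        intro y i j
        simp only [hB, Matrix.updateRow_apply, Function.update_apply]
        by_cases hi : i = a <;> by_cases hj : j = b <;> simp [hi, hj]
      have hbound : ∀ y, y = 0 ∨ y = t → |(B y).det| ≤ M := by
        intro y hy
        refine ih (B y) ⟨fun i j hij => ?_, fun i j hij => ?_, fun i j hij => ?_⟩
          fun i j hij hS => ?_
        · rw [hBapp]
          split_ifs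
          · rcases hy with rfl | rfl
            exacts [⟨le_rfl, ht.le⟩, ⟨ht.le, le_rfl⟩]
          · exact hA.1 i j hij
        · rw [hBapp, if_neg, hA.2.1 i j hij]
          rintro ⟨rfl, rfl⟩
          rw [Fin.le_def] at hab
          omega
        · rw [hBapp, if_neg, hA.2.2 i j hij]
          rintro ⟨rfl, rfl⟩
          rw [Fin.le_def] at hab
          omega
        · rw [hBapp]
          split_ifs with hx
          · exact hy
          · exact h i j hij (by simp [hx, hS])
      set c := A a b / t with hc
      have hc0 : 0 ≤ c := div_nonneg (hA.1 a b hab).1 ht.le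
      have hc1 : c ≤ 1 := (div_le_one ht).mpr (hA.1 a b hab).2
      have hrow : A a = (1 - c) • Function.update (A a) b 0 + c • Function.update (A a) b t := by
        ext j
        by_cases hj : j = b
        · subst hj
          simp [hc, ht.ne']
        · simp [hj]
          ring
      have hdet : A.det = (1 - c) * (B 0).det + c * (B t).det := by
        conv_lhs => rw [← Matrix.updateRow_eq_self A a, hrow]
        rw [Matrix.det_updateRow_add, Matrix.det_updateRow_smul, Matrix.det_updateRow_smul]
      have h0 := abs_le.mp (hbound 0 (Or.inl rfl))
      have h1 := abs_le.mp (hbound t (Or.inr rfl))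
      rw [hdet, abs_le]
      constructor <;> nlinarith
    · refine ih A hA fun i j hij hS => h i j hij ?_
      rw [Finset.mem_insert, not_or]
      refine ⟨?_, hS⟩
      rintro ⟨⟩
      exact hab hij

/-! ### The extremal matrix -/

theorem matW_mem_hessenbergSet (n : ℕ) (s : ℝ) {t : ℝ} (ht : 0 ≤ t) :
    matW n s t ∈ hessenbergSet n s (Set.Icc 0 t) := by
  refine ⟨fun i j hij => ?_, fun i j hij => ?_, fun i j hij => ?_⟩
  · rw [Fin.le_def] at hij
    rw [matW, Matrix.of_apply, if_neg (by omega)]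
    split_ifs
    exacts [⟨ht, le_rfl⟩, ⟨le_rfl, ht⟩]
  · rw [matW, Matrix.of_apply, if_pos hij]
  · rw [matW, Matrix.of_apply, if_neg (by omega), if_neg (by omega)]

theorem pathMatrix_matW {n : ℕ} {s t : ℝ} (ht : t ≠ 0) (p q : Fin (n + 1)) :
    pathMatrix t (matW n s t) p q =
      if ((p : ℕ) = 0 ∧ 1 ≤ (q : ℕ) ∧ (q : ℕ) ≤ (n - 1) / 2)
        ∨ ((p : ℕ) = 0 ∧ 1 ≤ (q : ℕ) ∧ (q : ℕ) = n)
        ∨ (1 ≤ (p : ℕ) ∧ (p : ℕ) ≤ (n - 1) / 2 ∧ (n - 1) / 2 < (q : ℕ) ∧ (q : ℕ) < n)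
        ∨ ((n - 1) / 2 < (p : ℕ) ∧ (p : ℕ) < n ∧ (q : ℕ) = n) then 1 else 0 := by
  induction p using Fin.lastCases with
  | last =>
    rw [pathMatrix_last, if_neg]
    rw [Fin.val_last]
    omega
  | cast i =>
    induction q using Fin.cases with
    | zero =>
      rw [pathMatrix_zero, if_neg]
      have := i.isLt
      simp only [Fin.val_castSucc, Fin.val_zero]
      omega
    | succ j =>
      have hi := i.isLt
      have hj := j.isLt
      rw [pathMatrix_castSucc_succ, matW, Matrix.of_apply]
      simp only [Fin.le_def, Fin.val_castSucc, Fin.val_succ]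
      split_ifs
      all_goals first
        | omega
        | simp [ht]

/-- Interior edges run only from `{1, …, k}` to `{k + 1, …, n - 1}`. Hence every path from `0` to
`n` is the direct edge or has length three, one for each of the `k * (n - 1 - k)` pairs. -/
theorem pathSum_matW {n : ℕ} {s t : ℝ} (ht : t ≠ 0) (hn : 1 ≤ n) :
    pathSum s t (matW n s t) 0 (Fin.last n)
      = 1 + (t / s) ^ 2 * ((n / 2 * ((n - 1) / 2) : ℕ) : ℝ) := by
  have h := isAlternatingPathSum_pathSum s t (matW n s t)
  set G := pathSum s t (matW n s t)
  set N := pathMatrix t (matW n s t) with hN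
  have hval := fun p q => pathMatrix_matW (s := s) ht p q (n := n)
  rw [← hN] at hval
  set k := (n - 1) / 2 with hk
  have hlate : ∀ p q : Fin (n + 1), k < (p : ℕ) → (q : ℕ) < n → G p q = 0 := by
    intro p q hp hq
    rw [h.apply_left, hval, if_neg (by omega), Finset.sum_eq_zero]
    · ring
    intro r _
    by_cases hr : (r : ℕ) = n
    · rw [h.eq_zero_of_le r q (by rw [Fin.le_def]; omega), mul_zero]
    · rw [hval, if_neg (by omega), zero_mul]
  have hmid : ∀ p q : Fin (n + 1), 1 ≤ (p : ℕ) → (p : ℕ) ≤ k → k < (q : ℕ) → (q : ℕ) < n →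
      G p q = 1 := by
    intro p q hp hp' hq hq'
    rw [h.apply_left, hval, if_pos (by omega), Finset.sum_eq_zero]
    · ring
    intro r _
    by_cases hr : k < (r : ℕ)
    · rw [hlate r q hr hq', mul_zero]
    · rw [hval, if_neg (by omega), zero_mul]
  have htwo : ∑ r, N 0 r * N r (Fin.last n) = 0 := by
    refine Finset.sum_eq_zero fun r _ => ?_
    rw [hval, hval]
    simp only [Fin.val_zero, Fin.val_last]
    split_ifs <;> first | omega | simp
  have hthree : ∀ i j : Fin (n + 1), N 0 i * G i j * N j (Fin.last n)
      = (if i ∈ Finset.Ioo 0 (⟨k + 1, by omega⟩ : Fin (n + 1)) then (1 : ℝ) else 0)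
        * (if j ∈ Finset.Ioo (⟨k, by omega⟩ : Fin (n + 1)) (Fin.last n) then (1 : ℝ) else 0) := by
    intro i j
    simp only [Finset.mem_Ioo, Fin.lt_def, Fin.val_zero, Fin.val_last]
    by_cases hi : 0 < (i : ℕ) ∧ (i : ℕ) < k + 1
    · by_cases hj : k < (j : ℕ) ∧ (j : ℕ) < n
      · rw [hmid i j hi.1 (by omega) hj.1 hj.2, hval, hval, if_pos hi, if_pos hj, if_pos, if_pos]
        · ring
        · simp only [and_true, Fin.val_last]
          omega
        · simp only [true_and, Fin.val_zero]
          omega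
      · rw [if_neg hj, mul_zero]
        by_cases hij : (j : ℕ) ≤ i
        · rw [h.eq_zero_of_le i j hij, mul_zero, zero_mul]
        · rw [hval j, if_neg, mul_zero]
          simp only [Fin.val_last]
          omega
    · rw [if_neg hi, zero_mul]
      by_cases hin : (i : ℕ) = n
      · rw [h.eq_zero_of_le i j (by rw [Fin.le_def]; omega), mul_zero, zero_mul]
      · rw [hval 0, if_neg, zero_mul, zero_mul]
        simp only [Fin.val_zero]
        omega
  rw [h.apply_two_sided, htwo]
  simp_rw [hthree, ← Finset.mul_sum, ← Finset.sum_mul]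
  rw [Finset.sum_boole, Finset.sum_boole, Finset.filter_mem_eq_inter, Finset.filter_mem_eq_inter,
    Finset.univ_inter, Finset.univ_inter, Fin.card_Ioo, Fin.card_Ioo, hval, if_pos]
  · simp only [Fin.val_zero, Fin.val_last, Nat.sub_zero, Nat.add_sub_cancel]
    rw [show n - k - 1 = n / 2 by omega]
    push_cast
    ring
  · simp only [true_and, and_true, Fin.val_zero, Fin.val_last]
    omega

/-! ### Numerical bounds for `arcosh 2` -/

theorem Real.sqrt_three_bounds : 1.732 < √(3 : ℝ) ∧ √(3 : ℝ) < 1.7321 :=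
  ⟨Real.lt_sqrt_of_sq_lt (by norm_num), (Real.sqrt_lt' (by norm_num)).mpr (by norm_num)⟩

theorem Real.five_fourths_lt_arcosh_two : 5 / 4 < Real.arcosh 2 := by
  rw [← Real.exp_lt_exp, Real.exp_arcosh (by norm_num),
    show (2 : ℝ) ^ 2 - 1 = 3 by norm_num]
  have h3 := Real.sqrt_three_bounds.1
  -- Fourth powers turn the claim into `e ^ 5 < (2 + √3) ^ 4`, within reach of decimal bounds for
  -- `e`.
  refine lt_of_pow_lt_pow_left₀ 4 (by positivity) ?_
  have hexp : Real.exp (5 / 4) ^ 4 = Real.exp 1 ^ 5 := by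
    rw [← Real.exp_nat_mul, ← Real.exp_nat_mul]
    norm_num
  rw [hexp]
  calc Real.exp 1 ^ 5 < 2.7182818286 ^ 5 := by
        gcongr
        exact Real.exp_one_lt_d9
    _ < (2 + 1.732) ^ 4 := by norm_num
    _ ≤ (2 + √3) ^ 4 := by gcongr

theorem Real.arcosh_two_lt_four_thirds : Real.arcosh 2 < 4 / 3 := by
  rw [← Real.exp_lt_exp, Real.exp_arcosh (by norm_num),
    show (2 : ℝ) ^ 2 - 1 = 3 by norm_num]
  have h3 := Real.sqrt_three_bounds.2
  refine lt_of_pow_lt_pow_left₀ 3 (by positivity) ?_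
  have hexp : Real.exp (4 / 3) ^ 3 = Real.exp 1 ^ 4 := by
    rw [← Real.exp_nat_mul, ← Real.exp_nat_mul]
    norm_num
  rw [hexp]
  calc (2 + √3) ^ 3 ≤ (2 + 1.7321) ^ 3 := by gcongr
    _ < 2.7182818283 ^ 4 := by norm_num
    _ < Real.exp 1 ^ 4 := by
        gcongr
        exact Real.exp_one_gt_d9

/-! ### Conclusion -/

theorem abs_det_le_maxDetValue {n : ℕ} {s t : ℝ} (hn : 1 ≤ n) (hs : 0 < s) (ht : 0 < t)
    (hst : t / s * (n : ℝ) ^ 2 ≤ 4 / 3) (A : Matrix (Fin n) (Fin n) ℝ)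
    (hA : A ∈ hessenbergSet n s (Set.Icc 0 t)) : |A.det| ≤ maxDetValue n s t := by
  refine abs_det_le_of_forall_vertex ht (fun A hA => ?_) A hA
  rw [abs_det_eq_of_mem_hessenbergSet hn hs ht hA, maxDetValue_eq hs hn]
  have h := isAlternatingPathSum_pathSum s t A
  have hε : 0 ≤ t / s := by positivity
  have h01 : ∀ p q, pathMatrix t A p q ∈ ({0, 1} : Set ℝ) :=
    pathMatrix_mem t A (by simp) fun i j hij => by
      rcases hA.1 i j hij with h | h
      · simp [h]
      · rw [Set.mem_singleton_iff] at h
        simp [h, ht.ne']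
  have hIcc : ∀ p q, pathMatrix t A p q ∈ Set.Icc (0 : ℝ) 1 := fun p q => by
    rcases h01 p q with h | h
    · simp [h]
    · rw [Set.mem_singleton_iff] at h
      simp [h]
  gcongr
  rw [abs_le]
  refine ⟨?_, h.apply_zero_last_le hε hst h01⟩
  have := h.neg_one_le hε hst hIcc 0 (Fin.last n)
  have : 0 ≤ (t / s) ^ 2 * ((n / 2 * ((n - 1) / 2) : ℕ) : ℝ) := by positivity
  linarith

theorem theorem2p9 :
    1 / Real.arcosh 2 < 4 / 5 ∧
    ∀ (n : ℕ) (s t : ℝ), 1 ≤ n → 0 < t → s / t > 1 / Real.arcosh 2 * (n : ℝ) ^ 2 →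
      IsGreatest ((fun A : Matrix (Fin n) (Fin n) ℝ => |A.det|) '' hessenbergSet n s (Set.Icc 0 t))
          (maxDetValue n s t) ∧
        matW n s t ∈ hessenbergSet n s (Set.Icc 0 t) ∧
        |(matW n s t).det| = maxDetValue n s t := by
  have hlow := Real.five_fourths_lt_arcosh_two
  have hpos : 0 < Real.arcosh 2 := by linarith
  refine ⟨by rw [div_lt_iff₀ hpos]; linarith, fun n s t hn ht hst => ?_⟩
  have hn0 : (0 : ℝ) < n := by exact_mod_cast hn
  have hs : 0 < s := by
    have : 0 < s / t := lt_trans (by positivity) hst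
    exact (div_pos_iff_of_pos_right ht).mp this
  have hsmall : t / s * (n : ℝ) ^ 2 ≤ 4 / 3 := by
    have h1 : (n : ℝ) ^ 2 < s / t * Real.arcosh 2 := by
      rw [gt_iff_lt, one_div_mul_eq_div, div_lt_iff₀ hpos] at hst
      exact hst
    calc t / s * (n : ℝ) ^ 2 ≤ t / s * (s / t * Real.arcosh 2) := by gcongr
      _ = Real.arcosh 2 := by field_simp
      _ ≤ 4 / 3 := Real.arcosh_two_lt_four_thirds.le
  have hmem := matW_mem_hessenbergSet n s ht.le
  have hdet : |(matW n s t).det| = maxDetValue n s t := by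
    rw [abs_det_eq_of_mem_hessenbergSet hn hs ht hmem, maxDetValue_eq hs hn,
      pathSum_matW ht.ne' hn, abs_of_nonneg (by positivity)]
  refine ⟨⟨⟨_, hmem, hdet⟩, ?_⟩, hmem, hdet⟩
  rintro _ ⟨A, hA, rfl⟩
  exact abs_det_le_maxDetValue hn hs ht hsmall A hA
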